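/- **Theorem (Chain rule and data processing inequality for the $\alpha$-Fisher information).** Let $m\ge 1$, $1<\alpha\le 2$ and $\theta\in\mathbb R^m$. For a family of random vectors $(V_\eta)_{\eta\in\mathbb R^m}$ with densities $p_{V_\eta}$ put $$J_\alpha(V_\theta;\theta)=-\mathbb E\Big[I^{\theta}_{2-\alpha}\big[\Delta_\theta \ln p_{V_\theta}\big](V_\theta)\Big],$$ where $\Delta_\theta$ is the Laplacian in the parameter and, for a family of functions $f_\eta$, $$I^{\theta}_{\nu}[f_\theta](x)=\frac{\Gamma\left(\frac m2-\frac{\nu}2\right)}{\pi^{m/2}\,2^{\nu}\,\Gamma\left(\frac{\nu}2\right)}\int_{\mathbb R^m}\|\theta-\eta\|^{-m+\nu} f_\eta(x)\,d\eta\quad(0<\nu<1),\qquad I_0^\theta[f_\theta](x)=f_\theta(x).$$ We say that $J_\alpha(V_\theta;\theta)$ exists if these integrals converge absolutely (the inner one for almost every value $x$ of $V_\theta$). Moreover put $$J_\alpha(Y_\theta;\theta\,|\,Z_\theta)=\mathbb E_{Z_\theta}\big[J_\alpha(Y_\theta;\theta\,|\,Z_\theta=z)\big],$$ where $J_\alpha(Y_\theta;\theta\,|\,Z_\theta=z)$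 is formed in the same way with the conditional densities $p_{Y_\eta|Z_\eta}(y|z)=p_{Y_\eta,Z_\eta}(y,z)/p_{Z_\eta}(z)$. It exists if $J_\alpha(Y_\theta;\theta\,|\,Z_\theta=z)$ exists for almost every value $z$ of $Z_\theta$ and is integrable under the law of $Z_\theta$. Let $Y_\eta$ and $Z_\eta$, $\eta\in\mathbb R^m$, be random vectors in $\mathbb R^d$ and $\mathbb R^k$ such that $\theta - Y_\theta - Z_\theta$ is a Markov chain, i.e. the conditional distribution of $Z_\eta$ given $Y_\eta$ does not depend on $\eta\in\mathbb R^m$. Suppose that each of the families $V=Y$, $V=Z$ and $V=(Y,Z)$ has densities $p_{V_\eta}(x)$, jointly measurable in $(\eta,x)$, such that for almost every $x$ under the law of $V_\theta$ the function $\eta\mapsto p_{V_\eta}(x)$ is positive and twice continuously differentiable on $\mathbb R^m$, and that $J_\alpha(Y_\theta;\theta)$ and $J_\alpha(Z_\theta;\theta)$ exist. Then $J_\alpha(Y_\theta,Z_\theta;\theta)$ and $J_\alpha(Y_\theta;\theta\,|\,Z_\theta)$ exist, $$J_\alpha(Y_\theta,Z_\theta;\theta)=J_\alpha(Z_\theta;\theta)+J_\alpha(Y_\theta;\theta\,|\,Z_\theta),\qquad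 J_\alpha(Y_\theta,Z_\theta;\theta)=J_\alpha(Y_\theta;\theta),$$ and, whenever $J_\alpha(Y_\theta;\theta\,|\,Z_\theta)\ge 0$, $$J_\alpha(Z_\theta;\theta)\le J_\alpha(Y_\theta;\theta).$$ -/

import Mathlib

open MeasureTheory ProbabilityTheory InnerProductSpace Laplacian

noncomputable section

/-- The kernel of the Riesz potential of order `ν` on `ℝᵐ`, with its normalizing constant:
`Γ((m - ν) / 2) / (π ^ (m / 2) 2 ^ ν Γ(ν / 2)) * ‖v‖ ^ (-m + ν)`. -/
def rieszKernel (m : ℕ) (ν : ℝ) (v : EuclideanSpace ℝ (Fin m)) : ℝ :=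
  Real.Gamma ((m : ℝ) / 2 - ν / 2) /
      (Real.pi ^ ((m : ℝ) / 2) * (2 : ℝ) ^ ν * Real.Gamma (ν / 2)) *
    ‖v‖ ^ (-(m : ℝ) + ν)

/-- The Riesz potential `I_ν(f)(θ) = ∫ rieszKernel (θ - η) f(η) dη` on `ℝᵐ`; the potential of
order `0` is the identity, `I_0(f) = f`. -/
def rieszPotential {m : ℕ} (ν : ℝ) (f : EuclideanSpace ℝ (Fin m) → ℝ)
    (θ : EuclideanSpace ℝ (Fin m)) : ℝ :=
  if ν = 0 then f θ else ∫ η, rieszKernel m ν (θ - η) * f η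

/-- The integral that defines the Riesz potential of `f` at `θ` converges absolutely (there is
nothing to require for the order `0`). -/
def RieszConvergent {m : ℕ} (ν : ℝ) (f : EuclideanSpace ℝ (Fin m) → ℝ)
    (θ : EuclideanSpace ℝ (Fin m)) : Prop :=
  ν = 0 ∨ Integrable (fun η => rieszKernel m ν (θ - η) * f η)

/-- For a family of functions `p η`, `η ∈ ℝᵐ`, and a point `x`: the function
`η ↦ Δ_η (ln p_η(x))`, the Laplacian being taken in the parameter. -/
def laplacianLog {m : ℕ} {X : Type*} (p : EuclideanSpace ℝ (Fin m) → X → ℝ) (x : X) :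
    EuclideanSpace ℝ (Fin m) → ℝ :=
  Δ (fun η => Real.log (p η x))

/-- The measure with density `q`. -/
def densityLaw {X : Type*} [MeasureSpace X] (q : X → ℝ) : Measure X :=
  volume.withDensity (fun x => ENNReal.ofReal (q x))

/-- The parametric `α`-Fisher information `-E (I^θ_{2-α}[Δ_θ ln p_θ](X_θ))` at `θ` of a
random element `X_θ` with density `p θ`. -/
def alphaFisherInfo {m : ℕ} {X : Type*} [MeasureSpace X] (α : ℝ)
    (p : EuclideanSpace ℝ (Fin m) → X → ℝ) (θ : EuclideanSpace ℝ (Fin m)) : ℝ :=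
  -∫ x, rieszPotential (2 - α) (laplacianLog p x) θ ∂(densityLaw (p θ))

/-- All integrals in the definition of `alphaFisherInfo α p θ` converge absolutely. -/
def AlphaFisherInfoExists {m : ℕ} {X : Type*} [MeasureSpace X] (α : ℝ)
    (p : EuclideanSpace ℝ (Fin m) → X → ℝ) (θ : EuclideanSpace ℝ (Fin m)) : Prop :=
  (∀ᵐ x ∂(densityLaw (p θ)), RieszConvergent (2 - α) (laplacianLog p x) θ) ∧
    Integrable (fun x => rieszPotential (2 - α) (laplacianLog p x) θ) (densityLaw (p θ))

/-- The conditional density `p_η(y | z) = p_η(y, z) / p_η(z)` of the first variable given that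
the second one is `z`. -/
def condDensity {Θ X Z : Type*} (pXZ : Θ → X × Z → ℝ) (pZ : Θ → Z → ℝ) (z : Z) : Θ → X → ℝ :=
  fun η x => pXZ η (x, z) / pZ η z

/-- The conditional parametric `α`-Fisher information `E_Z (J_α(X_θ; θ | Z_θ = z))`, for the
joint density `pXZ` and the density `pZ` of the conditioning variable. -/
def condAlphaFisherInfo {m : ℕ} {X Z : Type*} [MeasureSpace X] [MeasureSpace Z] (α : ℝ)
    (pXZ : EuclideanSpace ℝ (Fin m) → X × Z → ℝ) (pZ : EuclideanSpace ℝ (Fin m) → Z → ℝ)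
    (θ : EuclideanSpace ℝ (Fin m)) : ℝ :=
  ∫ z, alphaFisherInfo α (condDensity pXZ pZ z) θ ∂(densityLaw (pZ θ))

/-- All integrals in the definition of `condAlphaFisherInfo α pXZ pZ θ` converge absolutely. -/
def CondAlphaFisherInfoExists {m : ℕ} {X Z : Type*} [MeasureSpace X] [MeasureSpace Z] (α : ℝ)
    (pXZ : EuclideanSpace ℝ (Fin m) → X × Z → ℝ) (pZ : EuclideanSpace ℝ (Fin m) → Z → ℝ)
    (θ : EuclideanSpace ℝ (Fin m)) : Prop :=
  (∀ᵐ z ∂(densityLaw (pZ θ)), AlphaFisherInfoExists α (condDensity pXZ pZ z) θ) ∧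
    Integrable (fun z => alphaFisherInfo α (condDensity pXZ pZ z) θ) (densityLaw (pZ θ))

/-- `p` is a family of probability densities of the random elements `V η`, `η ∈ ℝᵐ`, jointly
measurable in the parameter and the point, such that for almost every `x` under the law of
`V θ` the likelihood `η ↦ p η x` is positive and twice continuously differentiable on `ℝᵐ`. -/
structure IsRegularDensity {m : ℕ} {Ω X : Type*} [MeasurableSpace Ω] [MeasureSpace X]
    (P : Measure Ω) (V : EuclideanSpace ℝ (Fin m) → Ω → X)
    (p : EuclideanSpace ℝ (Fin m) → X → ℝ) (θ : EuclideanSpace ℝ (Fin m)) : Prop where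
  measurable : Measurable (fun q : EuclideanSpace ℝ (Fin m) × X => p q.1 q.2)
  nonneg : ∀ η x, 0 ≤ p η x
  law_eq : ∀ η, P.map (V η) = densityLaw (p η)
  smooth : ∀ᵐ x ∂(P.map (V θ)), (∀ η, 0 < p η x) ∧ ContDiff ℝ 2 (fun η => p η x)

/-- `θ – Y_θ – Z_θ` is a Markov chain: the conditional distribution of `Z_θ` given `Y_θ` does
not depend on `θ`. -/
def IsParamMarkovChain {Θ Ω Y Z : Type*} [MeasurableSpace Ω] [MeasurableSpace Y]
    [MeasurableSpace Z] (P : Measure Ω) (Yv : Θ → Ω → Y) (Zv : Θ → Ω → Z) : Prop :=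
  ∃ κ : Kernel Y Z, IsMarkovKernel κ ∧
    ∀ η, P.map (fun ω => (Yv η ω, Zv η ω)) = (P.map (Yv η)).compProd κ

end

/-! Both identities hold pointwise, before expectations are taken. Since ln p(y|z) = ln p(y,z) - ln
p(z), and the Laplacian and the Riesz potential act linearly on functions of the parameter, the
chain rule follows by Fubini from the disintegration of the joint law along Z
(`IsRegularDensity.map_swap_densityLaw`). Along the Markov chain p_η(y,z) = c(y,z) p_η(y) with c
free of η, so the Laplacian kills ln c and the joint information is that of Y
(`IsParamMarkovChain.ae_laplacianLog_eq`). Comparing the two identities gives the inequality. The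
delicate point is null sets: the factorization is known almost everywhere for each η, whereas the
Laplacian needs it for all η at one point. Joint measurability and continuity in η bridge the gap.
-/

section Composition

variable {X Z : Type*} [MeasurableSpace X] [MeasurableSpace Z]

lemma withDensity_compProd (μ : Measure X) [SFinite μ] (κ : Kernel X Z) [IsSFiniteKernel κ]
    {f : X → ENNReal} (hf : Measurable f) :
    (μ.withDensity f).compProd κ = (μ.compProd κ).withDensity (fun q => f q.1) := by
  refine Measure.ext_of_lintegral _ fun h hh => ?_
  rw [Measure.lintegral_compProd hh, lintegral_withDensity_eq_lintegral_mul _ hf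
      hh.lintegral_kernel_prod_right', lintegral_withDensity_eq_lintegral_mul _ (by fun_prop) hh,
    Measure.lintegral_compProd (by fun_prop)]
  refine lintegral_congr fun x => ?_
  simp only [Pi.mul_apply]
  rw [lintegral_const_mul _ (by fun_prop)]

lemma withDensity_compProd_withDensity_const (μ : Measure X) (ν : Measure Z) [SFinite μ]
    [SFinite ν] {f : X → ENNReal} (hf : Measurable f) {g : X → Z → ENNReal}
    (hg : Measurable (Function.uncurry g)) [IsSFiniteKernel ((Kernel.const X ν).withDensity g)] :
    (μ.withDensity f).compProd ((Kernel.const X ν).withDensity g) =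
      (μ.prod ν).withDensity (fun q => f q.1 * g q.1 q.2) := by
  have hg' : Measurable (fun q : X × Z => g q.1 q.2) := hg
  refine Measure.ext_of_lintegral _ fun h hh => ?_
  rw [Measure.lintegral_compProd hh, lintegral_withDensity_eq_lintegral_mul _ hf
      hh.lintegral_kernel_prod_right', lintegral_withDensity_eq_lintegral_mul _ (by fun_prop) hh,
    lintegral_prod _ (by fun_prop)]
  refine lintegral_congr fun x => ?_
  have hgx : Measurable (g x) := hg'.comp measurable_prodMk_left
  simp only [Pi.mul_apply]
  rw [Kernel.lintegral_withDensity _ hg _ (by fun_prop), Kernel.const_apply,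
    ← lintegral_const_mul _ (by fun_prop)]
  simp only [mul_assoc]

end Composition

section Regular

variable {m : ℕ} {Ω X : Type*} [MeasurableSpace Ω] [MeasureSpace X] {P : Measure Ω}
  {V : EuclideanSpace ℝ (Fin m) → Ω → X} {p : EuclideanSpace ℝ (Fin m) → X → ℝ}
  {θ : EuclideanSpace ℝ (Fin m)}

lemma IsRegularDensity.measurable_density (h : IsRegularDensity P V p θ)
    (η : EuclideanSpace ℝ (Fin m)) : Measurable (p η) :=
  h.measurable.comp measurable_prodMk_left

lemma IsRegularDensity.ae_smooth (h : IsRegularDensity P V p θ) :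
    ∀ᵐ x ∂(densityLaw (p θ)), (∀ η, 0 < p η x) ∧ ContDiff ℝ 2 (fun η => p η x) :=
  h.law_eq θ ▸ h.smooth

end Regular

/-! ### Laplacians of log-likelihoods and linearity of the Riesz potential. -/

section Laplacian

variable {m : ℕ}

/-- The logarithm turns the factor into an additive constant, which is harmonic. -/
lemma laplacianLog_eq_of_forall_eq_mul {X X' : Type*} {p : EuclideanSpace ℝ (Fin m) → X → ℝ}
    {q : EuclideanSpace ℝ (Fin m) → X' → ℝ} {x : X} {x' : X'} {c : ℝ} (hc : 0 < c)
    (hq : ∀ η, 0 < q η x') (hqs : ContDiff ℝ 2 (fun η => q η x'))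
    (h : ∀ η, p η x = c * q η x') : laplacianLog p x = laplacianLog q x' := by
  have hlog : (fun η => Real.log (p η x)) =
      (fun _ => Real.log c) + fun η => Real.log (q η x') := by
    funext η
    simp only [Pi.add_apply, h, Real.log_mul hc.ne' (hq η).ne']
  funext η
  simp only [laplacianLog, hlog]
  rw [ContDiffAt.laplacian_add contDiffAt_const (hqs.log fun η => (hq η).ne').contDiffAt,
    laplacian_const, Pi.zero_apply, zero_add]

lemma laplacianLog_condDensity {X Z : Type*} {pXZ : EuclideanSpace ℝ (Fin m) → X × Z → ℝ}
    {pZ : EuclideanSpace ℝ (Fin m) → Z → ℝ} {x : X} {z : Z}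
    (hXZ : ∀ η, 0 < pXZ η (x, z)) (hXZs : ContDiff ℝ 2 (fun η => pXZ η (x, z)))
    (hZ : ∀ η, 0 < pZ η z) (hZs : ContDiff ℝ 2 (fun η => pZ η z)) :
    laplacianLog (condDensity pXZ pZ z) x =
      fun η => laplacianLog pXZ (x, z) η - laplacianLog pZ z η := by
  have hlog : (fun η => Real.log (condDensity pXZ pZ z η x)) =
      (fun η => Real.log (pXZ η (x, z))) - fun η => Real.log (pZ η z) := by
    funext η
    simp only [Pi.sub_apply, condDensity, Real.log_div (hXZ η).ne' (hZ η).ne']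
  funext η
  simp only [laplacianLog, hlog]
  exact ContDiffAt.laplacian_sub (hXZs.log fun η => (hXZ η).ne').contDiffAt
    (hZs.log fun η => (hZ η).ne').contDiffAt

lemma RieszConvergent.sub {ν : ℝ} {f g : EuclideanSpace ℝ (Fin m) → ℝ}
    {θ : EuclideanSpace ℝ (Fin m)} (hf : RieszConvergent ν f θ) (hg : RieszConvergent ν g θ) :
    RieszConvergent ν (fun η => f η - g η) θ := by
  by_cases hν : ν = 0
  · exact Or.inl hν
  · refine Or.inr ?_
    simp only [mul_sub]
    exact (hf.resolve_left hν).sub (hg.resolve_left hν)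

lemma rieszPotential_sub {ν : ℝ} {f g : EuclideanSpace ℝ (Fin m) → ℝ}
    {θ : EuclideanSpace ℝ (Fin m)} (hf : RieszConvergent ν f θ) (hg : RieszConvergent ν g θ) :
    rieszPotential ν (fun η => f η - g η) θ = rieszPotential ν f θ - rieszPotential ν g θ := by
  by_cases hν : ν = 0
  · simp [rieszPotential, hν]
  · simp only [rieszPotential, if_neg hν, mul_sub]
    exact integral_sub (hf.resolve_left hν) (hg.resolve_left hν)

end Laplacian

section Marginals

variable {m : ℕ} {Ω Y Z : Type*} [MeasurableSpace Ω] [MeasureSpace Y] [MeasureSpace Z]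
  {P : Measure Ω} {Yv : EuclideanSpace ℝ (Fin m) → Ω → Y} {Zv : EuclideanSpace ℝ (Fin m) → Ω → Z}
  {θ : EuclideanSpace ℝ (Fin m)} {pY : EuclideanSpace ℝ (Fin m) → Y → ℝ}
  {pZ : EuclideanSpace ℝ (Fin m) → Z → ℝ} {pYZ : EuclideanSpace ℝ (Fin m) → Y × Z → ℝ}

lemma map_fst_densityLaw (hZ : ∀ η, Measurable (Zv η)) (hY : ∀ η, Measurable (Yv η))
    (hpY : IsRegularDensity P Yv pY θ)
    (hpYZ : IsRegularDensity P (fun η ω => (Yv η ω, Zv η ω)) pYZ θ) :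
    (densityLaw (pYZ θ)).map Prod.fst = densityLaw (pY θ) := by
  rw [← hpYZ.law_eq, ← hpY.law_eq, Measure.map_map measurable_fst ((hY θ).prodMk (hZ θ))]
  rfl

lemma map_snd_densityLaw (hZ : ∀ η, Measurable (Zv η)) (hY : ∀ η, Measurable (Yv η))
    (hpZ : IsRegularDensity P Zv pZ θ)
    (hpYZ : IsRegularDensity P (fun η ω => (Yv η ω, Zv η ω)) pYZ θ) :
    (densityLaw (pYZ θ)).map Prod.snd = densityLaw (pZ θ) := by
  rw [← hpYZ.law_eq, ← hpZ.law_eq, Measure.map_map measurable_snd ((hY θ).prodMk (hZ θ))]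
  rfl

end Marginals

/-! ### Markov factorization, disintegration along Z, and the two identities. -/

section Markov

variable {m : ℕ} {Ω Y Z : Type*} [MeasurableSpace Ω] [MeasureSpace Y] [MeasureSpace Z]
  [SigmaFinite (volume : Measure Y)] [SigmaFinite (volume : Measure Z)]
  {P : Measure Ω} {Yv : EuclideanSpace ℝ (Fin m) → Ω → Y} {Zv : EuclideanSpace ℝ (Fin m) → Ω → Z}
  {θ : EuclideanSpace ℝ (Fin m)} {pY : EuclideanSpace ℝ (Fin m) → Y → ℝ}
  {pZ : EuclideanSpace ℝ (Fin m) → Z → ℝ} {pYZ : EuclideanSpace ℝ (Fin m) → Y × Z → ℝ}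

/-- Along a Markov chain, the ratio of the joint density and the density of the first variable
does not depend on the parameter. -/
lemma IsParamMarkovChain.ae_mul_eq_mul (hM : IsParamMarkovChain P Yv Zv)
    (hpY : IsRegularDensity P Yv pY θ)
    (hpYZ : IsRegularDensity P (fun η ω => (Yv η ω, Zv η ω)) pYZ θ)
    (η : EuclideanSpace ℝ (Fin m)) :
    ∀ᵐ q : Y × Z, pYZ η q * pY θ q.1 = pYZ θ q * pY η q.1 := by
  obtain ⟨κ, hκ, hlaw⟩ := hM
  have hmY := hpY.measurable_density
  have hmYZ := hpYZ.measurable_density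
  have hmY' : ∀ η, Measurable (fun q : Y × Z => pY η q.1) :=
    fun η => (hmY η).comp measurable_fst
  -- Weighting the law at `η` by the density of Y at `η'` makes the right-hand side symmetric in `η`
  -- and `η'`. Exchanging them yields the claim without any division.
  have hjoint : ∀ η η', (volume : Measure (Y × Z)).withDensity
      (fun q => ENNReal.ofReal (pYZ η q * pY η' q.1)) =
      (((volume : Measure Y).withDensity
        (fun y => ENNReal.ofReal (pY η y * pY η' y))).compProd κ) := by
    intro η η'
    have h1 := hlaw η
    rw [hpYZ.law_eq, hpY.law_eq] at h1
    have h2 := congrArg (fun μ => μ.withDensity (fun q => ENNReal.ofReal (pY η' q.1))) h1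
    simp only [densityLaw] at h2
    rw [← withDensity_mul _ (hmYZ η).ennreal_ofReal (hmY' η').ennreal_ofReal,
      ← withDensity_compProd _ _ (hmY η').ennreal_ofReal,
      ← withDensity_mul _ (hmY η).ennreal_ofReal (hmY η').ennreal_ofReal] at h2
    convert h2 using 2
    · funext q
      simp [ENNReal.ofReal_mul (hpYZ.nonneg _ _)]
    · congr 1
      funext q
      simp [ENNReal.ofReal_mul (hpY.nonneg _ _)]
  have heq : (volume : Measure (Y × Z)).withDensity
      (fun q => ENNReal.ofReal (pYZ η q * pY θ q.1)) =
      (volume : Measure (Y × Z)).withDensity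
      (fun q => ENNReal.ofReal (pYZ θ q * pY η q.1)) := by
    rw [hjoint, hjoint]
    simp only [mul_comm]
  have hae := (withDensity_eq_iff_of_sigmaFinite
    ((hmYZ η).mul (hmY' θ)).ennreal_ofReal.aemeasurable
    ((hmYZ θ).mul (hmY' η)).ennreal_ofReal.aemeasurable).1 heq
  filter_upwards [hae] with q hq
  exact (ENNReal.ofReal_eq_ofReal_iff (mul_nonneg (hpYZ.nonneg _ _) (hpY.nonneg _ _))
    (mul_nonneg (hpYZ.nonneg _ _) (hpY.nonneg _ _))).1 hq

lemma IsParamMarkovChain.ae_laplacianLog_eq (hM : IsParamMarkovChain P Yv Zv)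
    (hZ : ∀ η, Measurable (Zv η)) (hY : ∀ η, Measurable (Yv η))
    (hpY : IsRegularDensity P Yv pY θ)
    (hpYZ : IsRegularDensity P (fun η ω => (Yv η ω, Zv η ω)) pYZ θ) :
    ∀ᵐ q ∂(densityLaw (pYZ θ)), laplacianLog pYZ q = laplacianLog pY q.1 := by
  have hmeas : MeasurableSet {r : EuclideanSpace ℝ (Fin m) × (Y × Z) |
      pYZ r.1 r.2 * pY θ r.2.1 = pYZ θ r.2 * pY r.1 r.2.1} := by
    refine measurableSet_eq_fun ?_ ?_
    · exact hpYZ.measurable.mul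
        ((hpY.measurable_density θ).comp (measurable_fst.comp measurable_snd))
    · exact ((hpYZ.measurable_density θ).comp measurable_snd).mul
        (hpY.measurable.comp (measurable_fst.prodMk (measurable_fst.comp measurable_snd)))
  -- Fubini exchanges the quantifiers, so that the exceptional set of `q` no longer depends on `η`.
  have hvol : ∀ᵐ q : Y × Z, ∀ᵐ η : EuclideanSpace ℝ (Fin m),
      pYZ η q * pY θ q.1 = pYZ θ q * pY η q.1 :=
    (Measure.ae_ae_comm hmeas).1 (Filter.Eventually.of_forall (hM.ae_mul_eq_mul hpY hpYZ))
  have hfst := hpY.ae_smooth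
  rw [← map_fst_densityLaw hZ hY hpY hpYZ] at hfst
  filter_upwards [(withDensity_absolutelyContinuous _ _).ae_le hvol, hpYZ.ae_smooth,
    ae_of_ae_map measurable_fst.aemeasurable hfst] with q hq hs hs'
  -- Continuous functions that agree Lebesgue-almost everywhere agree everywhere.
  have hall : (fun η => pYZ η q * pY θ q.1) = fun η => pYZ θ q * pY η q.1 :=
    Continuous.ae_eq_iff_eq volume (hs.2.continuous.mul continuous_const)
      (continuous_const.mul hs'.2.continuous) |>.1 hq
  refine laplacianLog_eq_of_forall_eq_mul (div_pos (hs.1 θ) (hs'.1 θ)) hs'.1 hs'.2 fun η => ?_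
  have hη := congrFun hall η
  have := (hs'.1 θ).ne'
  field_simp
  linarith

/-- The swap puts the conditioning variable first. The kernel is only claimed to be s-finite: where
`pZ θ z = 0`, division by zero makes the conditional density vanish. -/
lemma IsRegularDensity.map_swap_densityLaw (hZ : ∀ η, Measurable (Zv η))
    (hY : ∀ η, Measurable (Yv η)) (hpZ : IsRegularDensity P Zv pZ θ)
    (hpYZ : IsRegularDensity P (fun η ω => (Yv η ω, Zv η ω)) pYZ θ) :
    ∃ κ : Kernel Z Y, IsSFiniteKernel κ ∧ (∀ z, κ z = densityLaw (condDensity pYZ pZ z θ)) ∧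
      (densityLaw (pYZ θ)).map Prod.swap = (densityLaw (pZ θ)).compProd κ := by
  have hmZ := hpZ.measurable_density θ
  have hmYZ := hpYZ.measurable_density θ
  have hmc : Measurable (Function.uncurry
      fun z y => ENNReal.ofReal (condDensity pYZ pZ z θ y)) :=
    ((hmYZ.comp measurable_swap).div (hmZ.comp measurable_fst)).ennreal_ofReal
  refine ⟨(Kernel.const Z (volume : Measure Y)).withDensity
    fun z y => ENNReal.ofReal (condDensity pYZ pZ z θ y),
    Kernel.IsSFiniteKernel.withDensity _ fun _ _ => ENNReal.ofReal_ne_top, fun z => ?_, ?_⟩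
  · rw [Kernel.withDensity_apply _ hmc, Kernel.const_apply, densityLaw]
  · have hpos := hpZ.ae_smooth
    rw [← map_snd_densityLaw hZ hY hpZ hpYZ] at hpos
    have hpos' := (ae_withDensity_iff hmYZ.ennreal_ofReal).1
      (ae_of_ae_map measurable_snd.aemeasurable hpos)
    have : IsSFiniteKernel ((Kernel.const Z (volume : Measure Y)).withDensity
        fun z y => ENNReal.ofReal (condDensity pYZ pZ z θ y)) :=
      Kernel.IsSFiniteKernel.withDensity _ fun _ _ => ENNReal.ofReal_ne_top
    have hd : (fun q => ENNReal.ofReal (pYZ θ q)) =ᵐ[volume] fun q : Y × Z =>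
        ENNReal.ofReal (pZ θ q.2) * ENNReal.ofReal (condDensity pYZ pZ q.2 θ q.1) := by
      filter_upwards [hpos'] with q hq
      -- Positivity of `pZ θ` is available only where the joint density is nonzero; elsewhere both
      -- sides vanish.
      by_cases h0 : ENNReal.ofReal (pYZ θ q) = 0
      · have : pYZ θ q = 0 := le_antisymm (ENNReal.ofReal_eq_zero.1 h0) (hpYZ.nonneg _ _)
        simp [condDensity, this]
      · rw [← ENNReal.ofReal_mul (hpZ.nonneg _ _), condDensity,
          mul_div_cancel₀ _ ((hq h0).1 θ).ne']
    have hmr : Measurable fun q : Z × Y =>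
        ENNReal.ofReal (pZ θ q.1) * ENNReal.ofReal (condDensity pYZ pZ q.1 θ q.2) :=
      (hmZ.comp measurable_fst).ennreal_ofReal.mul hmc
    simp only [densityLaw]
    rw [withDensity_compProd_withDensity_const _ _ hmZ.ennreal_ofReal hmc,
      withDensity_congr_ae hd]
    refine Measure.ext_of_lintegral _ fun h hh => ?_
    rw [lintegral_map hh measurable_swap, lintegral_withDensity_eq_lintegral_mul _ hmr hh]
    refine (lintegral_withDensity_eq_lintegral_mul _ (hmr.comp measurable_swap)
      (hh.comp measurable_swap)).trans ?_
    exact lintegral_prod_swap (μ := (volume : Measure Z)) (ν := (volume : Measure Y))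
      (fun q => ENNReal.ofReal (pZ θ q.1) * ENNReal.ofReal (condDensity pYZ pZ q.1 θ q.2) * h q)

/-- The joint `α`-Fisher information of a Markov chain is that of its first variable. -/
lemma IsParamMarkovChain.alphaFisherInfo_joint (hM : IsParamMarkovChain P Yv Zv) {α : ℝ}
    (hZ : ∀ η, Measurable (Zv η)) (hY : ∀ η, Measurable (Yv η))
    (hpY : IsRegularDensity P Yv pY θ)
    (hpYZ : IsRegularDensity P (fun η ω => (Yv η ω, Zv η ω)) pYZ θ)
    (hJ : AlphaFisherInfoExists α pY θ) :
    AlphaFisherInfoExists α pYZ θ ∧ alphaFisherInfo α pYZ θ = alphaFisherInfo α pY θ := by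
  have hfst := map_fst_densityLaw hZ hY hpY hpYZ
  have hlap := hM.ae_laplacianLog_eq hZ hY hpY hpYZ
  have hpot : (fun q => rieszPotential (2 - α) (laplacianLog pYZ q) θ) =ᵐ[densityLaw (pYZ θ)]
      fun q => rieszPotential (2 - α) (laplacianLog pY q.1) θ := by
    filter_upwards [hlap] with q hq
    rw [hq]
  obtain ⟨hc, hi⟩ := hJ
  refine ⟨⟨?_, ?_⟩, ?_⟩
  · rw [← hfst] at hc
    filter_upwards [hlap, ae_of_ae_map measurable_fst.aemeasurable hc] with q hq hq'
    rwa [hq]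
  · rw [← hfst] at hi
    exact (hi.comp_measurable measurable_fst).congr hpot.symm
  · rw [alphaFisherInfo, alphaFisherInfo, integral_congr_ae hpot, ← hfst,
      integral_map measurable_fst.aemeasurable (hfst ▸ hi.aestronglyMeasurable)]

/-- The chain rule for the `α`-Fisher information. -/
lemma IsRegularDensity.alphaFisherInfo_chain_rule {α : ℝ}
    (hZ : ∀ η, Measurable (Zv η)) (hY : ∀ η, Measurable (Yv η))
    (hpZ : IsRegularDensity P Zv pZ θ)
    (hpYZ : IsRegularDensity P (fun η ω => (Yv η ω, Zv η ω)) pYZ θ)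
    (hJZ : AlphaFisherInfoExists α pZ θ) (hJYZ : AlphaFisherInfoExists α pYZ θ) :
    CondAlphaFisherInfoExists α pYZ pZ θ ∧
      alphaFisherInfo α pYZ θ = alphaFisherInfo α pZ θ + condAlphaFisherInfo α pYZ pZ θ := by
  obtain ⟨κ, hκ, hκd, hdis⟩ := hpZ.map_swap_densityLaw hZ hY hpYZ
  have hsnd := map_snd_densityLaw hZ hY hpZ hpYZ
  have : SFinite (densityLaw (pZ θ)) := by unfold densityLaw; infer_instance
  set RYZ : Y × Z → ℝ := fun q => rieszPotential (2 - α) (laplacianLog pYZ q) θ with hRYZ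
  set RZ : Z → ℝ := fun z => rieszPotential (2 - α) (laplacianLog pZ z) θ with hRZ
  have hiZ : Integrable (fun q : Y × Z => RZ q.2) (densityLaw (pYZ θ)) := by
    have h := hJZ.2
    rw [← hsnd] at h
    exact h.comp_measurable measurable_snd
  have hiD : Integrable (fun q : Y × Z => RYZ q - RZ q.2) (densityLaw (pYZ θ)) := hJYZ.2.sub hiZ
  have hiD' : Integrable (fun q : Z × Y => RYZ q.swap - RZ q.1)
      ((densityLaw (pZ θ)).compProd κ) := by
    rw [← hdis]
    refine (MeasurableEquiv.prodComm.measurableEmbedding.integrable_map_iff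
      (g := fun q : Z × Y => RYZ q.swap - RZ q.1)).2 ?_
    exact hiD
  have hcond : ∀ᵐ q ∂(densityLaw (pYZ θ)),
      RieszConvergent (2 - α) (laplacianLog (condDensity pYZ pZ q.2) q.1) θ ∧
      rieszPotential (2 - α) (laplacianLog (condDensity pYZ pZ q.2) q.1) θ = RYZ q - RZ q.2 := by
    have h1 := hpZ.ae_smooth
    have h2 := hJZ.1
    rw [← hsnd] at h1 h2
    filter_upwards [ae_of_ae_map measurable_snd.aemeasurable h1,
      ae_of_ae_map measurable_snd.aemeasurable h2, hpYZ.ae_smooth, hJYZ.1] with q hs hc hs' hc'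
    rw [laplacianLog_condDensity hs'.1 hs'.2 hs.1 hs.2]
    exact ⟨hc'.sub hc, rieszPotential_sub hc' hc⟩
  have hcond' : ∀ᵐ q ∂((densityLaw (pZ θ)).compProd κ),
      RieszConvergent (2 - α) (laplacianLog (condDensity pYZ pZ q.1) q.2) θ ∧
      rieszPotential (2 - α) (laplacianLog (condDensity pYZ pZ q.1) q.2) θ =
        RYZ q.swap - RZ q.1 := by
    rw [← hdis]
    exact (MeasurableEquiv.prodComm.measurableEmbedding.ae_map_iff
      (μ := densityLaw (pYZ θ))).2 hcond
  have hfib := Measure.ae_ae_of_ae_compProd hcond'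
  simp only [hκd] at hfib
  -- Integrability of the difference on almost every fibre is what makes the conditional information
  -- exist for almost every `z`.
  have hfibi := ((Measure.integrable_compProd_iff hiD'.aestronglyMeasurable).1 hiD').1
  simp only [hκd] at hfibi
  have hinfo : (fun z => alphaFisherInfo α (condDensity pYZ pZ z) θ) =ᵐ[densityLaw (pZ θ)]
      fun z => -∫ y, (RYZ (y, z) - RZ z) ∂(κ z) := by
    filter_upwards [hfib] with z hz
    rw [alphaFisherInfo, hκd]
    exact congrArg Neg.neg (integral_congr_ae (hz.mono fun y hy => hy.2))
  refine ⟨⟨?_, ?_⟩, ?_⟩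
  · filter_upwards [hfib, hfibi] with z hz hz'
    exact ⟨hz.mono fun y hy => hy.1, hz'.congr (hz.mono fun y hy => hy.2.symm)⟩
  · exact (Integrable.integral_compProd hiD').neg.congr hinfo.symm
  · have hint : ∫ z, ∫ y, (RYZ (y, z) - RZ z) ∂(κ z) ∂(densityLaw (pZ θ)) =
        ∫ q, RYZ q ∂(densityLaw (pYZ θ)) - ∫ z, RZ z ∂(densityLaw (pZ θ)) := by
      refine (Measure.integral_compProd hiD').symm.trans ?_
      rw [← hdis]
      refine (MeasurableEquiv.prodComm.measurableEmbedding.integral_map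
        (μ := densityLaw (pYZ θ)) (fun q : Z × Y => RYZ q.swap - RZ q.1)).trans ?_
      refine (integral_sub hJYZ.2 hiZ).trans ?_
      rw [← hsnd, integral_map measurable_snd.aemeasurable (hsnd ▸ hJZ.2.aestronglyMeasurable)]
    rw [condAlphaFisherInfo, integral_congr_ae hinfo, integral_neg, hint]
    simp only [alphaFisherInfo, hRYZ, hRZ]
    ring

end Markov

theorem mainTheorem6 {Ω : Type*} [MeasurableSpace Ω] (P : Measure Ω) [IsProbabilityMeasure P]
    (m d k : ℕ) (hm : 0 < m) (α : ℝ) (hα : 1 < α) (hα' : α ≤ 2)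
    (Y : EuclideanSpace ℝ (Fin m) → Ω → EuclideanSpace ℝ (Fin d))
    (Z : EuclideanSpace ℝ (Fin m) → Ω → EuclideanSpace ℝ (Fin k))
    (hY : ∀ η, Measurable (Y η)) (hZ : ∀ η, Measurable (Z η))
    (hMarkov : IsParamMarkovChain P Y Z)
    (θ : EuclideanSpace ℝ (Fin m))
    (pY : EuclideanSpace ℝ (Fin m) → EuclideanSpace ℝ (Fin d) → ℝ)
    (pZ : EuclideanSpace ℝ (Fin m) → EuclideanSpace ℝ (Fin k) → ℝ)
    (pYZ : EuclideanSpace ℝ (Fin m) → EuclideanSpace ℝ (Fin d) × EuclideanSpace ℝ (Fin k) → ℝ)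
    (hpY : IsRegularDensity P Y pY θ) (hpZ : IsRegularDensity P Z pZ θ)
    (hpYZ : IsRegularDensity P (fun η ω => (Y η ω, Z η ω)) pYZ θ)
    (hJY : AlphaFisherInfoExists α pY θ) (hJZ : AlphaFisherInfoExists α pZ θ) :
    AlphaFisherInfoExists α pYZ θ ∧
    CondAlphaFisherInfoExists α pYZ pZ θ ∧
    alphaFisherInfo α pYZ θ = alphaFisherInfo α pZ θ + condAlphaFisherInfo α pYZ pZ θ ∧
    alphaFisherInfo α pYZ θ = alphaFisherInfo α pY θ ∧
    (0 ≤ condAlphaFisherInfo α pYZ pZ θ → alphaFisherInfo α pZ θ ≤ alphaFisherInfo α pY θ) := by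
  obtain ⟨hJYZ, hYZ⟩ := hMarkov.alphaFisherInfo_joint hZ hY hpY hpYZ hJY
  obtain ⟨hcond, hchain⟩ := hpZ.alphaFisherInfo_chain_rule hZ hY hpYZ hJZ hJYZ
  exact ⟨hJYZ, hcond, hchain, hYZ, fun h => by linarith⟩
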